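/- Let $d\ge 1$ be an integer. For $f\in L^2(\mathbb R^d,\mathbb C)$ let $\mathcal F f$ be its Fourier transform, normalised so that $(\mathcal F f)(k)=(2\pi)^{-d/2}\int_{\mathbb R^d}e^{-ik\cdot x}f(x)\,dx$ for integrable $f$. For real $n\ge 0$ let $$H^n=\Big\{f\in L^2(\mathbb R^d,\mathbb C)\ :\ \|f\|_n:=\Big(\int_{\mathbb R^d}(1+|k|^2)^n\,|(\mathcal F f)(k)|^2\,dk\Big)^{1/2}<\infty\Big\}.$$ Let $a$ be a real number with $a>d/2$. For real $n\ge a$ let $K_{n,a,d}$ be the sharp, i.e. minimum, constant $K$ such that, for all $f,g\in H^n$, the pointwise product $fg$ lies in $H^n$ and $$\|fg\|_n\le K\,\max\big(\|f\|_a\|g\|_n,\ \|f\|_n\|g\|_a\big).$$ This minimum exists for every real $n\ge a$ and, for fixed $a$ and $d$, as $n\to+\infty$ through the real numbers, $$\lim_{n\to+\infty}\frac{\log_2 K_{n,a,d}}{n}=1.$$ -/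

import Mathlib

open MeasureTheory Filter
open scoped FourierTransform ENNReal Topology

noncomputable section

namespace SobolevProduct

/-- The (classes of) square integrable functions on `ℝ^d` with complex values. -/
abbrev L2 (d : ℕ) : Type := Lp ℂ 2 (volume : Measure (EuclideanSpace ℝ (Fin d)))

/-- The unitary Fourier transform of `f ∈ L²(ℝ^d, ℂ)`, in the normalization
`(F f)(k) = (2 π)^(-d/2) ∫ e^(-i k·x) f(x) dx`. It is obtained from Mathlib's (Plancherel)
Fourier transform on `L²`, normalized as `(𝓕 f)(ξ) = ∫ e^(-2 π i ξ·x) f(x) dx`, through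
`ξ = k / (2 π)`. -/
def angularFourier {d : ℕ} (f : L2 d) (k : EuclideanSpace ℝ (Fin d)) : ℂ :=
  (((2 * Real.pi) ^ (-(d : ℝ) / 2) : ℝ) : ℂ) * (𝓕 f : L2 d) ((2 * Real.pi)⁻¹ • k)

/-- The function `k ↦ √(1 + |k|²)^n (F f)(k)`. -/
def weightedFourier {d : ℕ} (n : ℝ) (f : L2 d) (k : EuclideanSpace ℝ (Fin d)) : ℂ :=
  ((Real.sqrt (1 + ‖k‖ ^ 2) ^ n : ℝ) : ℂ) * angularFourier f k

/-- `f ∈ H^n(ℝ^d, ℂ)`, i.e. `√(1 + |k|²)^n (F f)` is in `L²`. This is used for orders `n ≥ 0` only,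
where the Sobolev space `H^n` is a subspace of `H^0 = L²`. -/
def MemH {d : ℕ} (n : ℝ) (f : L2 d) : Prop :=
  MemLp (weightedFourier n f) 2 volume

/-- The Sobolev norm `‖f‖_n = ‖ √(1 + |k|²)^n (F f) ‖_{L²}` (meaningful for `f ∈ H^n`). -/
def sobolevNorm {d : ℕ} (n : ℝ) (f : L2 d) : ℝ :=
  (eLpNorm (weightedFourier n f) 2 volume).toReal

/-- The pointwise product `f g` is (a.e. equal to) an element of `H^n`, of norm at most `C`. -/
def ProductBound {d : ℕ} (n : ℝ) (f g : L2 d) (C : ℝ) : Prop :=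
  ∃ h : L2 d, (∀ᵐ x, h x = f x * g x) ∧ MemH n h ∧ sobolevNorm n h ≤ C

/-- `K` is an admissible constant in the product inequality of orders `n`, `a` on `ℝ^d`.
If `0 ≤ n ≤ d/2 < a` this means `‖f g‖_n ≤ K ‖f‖_a ‖g‖_n` for all `f ∈ H^a`, `g ∈ H^n`; if
`n ≥ a > d/2`, it means `‖f g‖_n ≤ K max (‖f‖_a ‖g‖_n, ‖f‖_n ‖g‖_a)` for all `f, g ∈ H^n`.
No other pairs `(n, a)` are considered. -/
def IsProductConstant (d : ℕ) (n a K : ℝ) : Prop :=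
  if n ≤ (d : ℝ) / 2 then
    ∀ f g : L2 d, MemH a f → MemH n g →
      ProductBound n f g (K * (sobolevNorm a f * sobolevNorm n g))
  else
    ∀ f g : L2 d, MemH n f → MemH n g →
      ProductBound n f g
        (K * max (sobolevNorm a f * sobolevNorm n g) (sobolevNorm n f * sobolevNorm a g))

/-- The sharp constant `K_{n, a, d}`. -/
def sharpConstant (d : ℕ) (n a : ℝ) : ℝ :=
  sInf {K : ℝ | IsProductConstant d n a K}

end SobolevProduct

end

/-! On the Fourier side a product becomes a convolution, so the growth of the constant is decided by
how much the weight `⟨ξ⟩ = bracket ξ` can increase when two frequencies are added. The answer is a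
factor of at most 2, approached at high frequency.

Upper bound (`isProductConstant_two_rpow`): `⟨x + y⟩ ^ n ≤ 2 ^ n (⟨x⟩ ^ n + ⟨y⟩ ^ n)` splits the
weighted convolution into two terms. Young's inequality `L¹ * L² ⊆ L²` bounds each, and the `L¹`
norms are controlled by the norm of order `a` because `a > d/2`. Hence `K ≤ C 2 ^ n` with `C`
independent of `n`.

Lower bound (`exists_lower_bound`): take `f = g` with Fourier transform the indicator of a unit ball
centred far from the origin, at `e`. The transform of `f²` lives near `2e`, where the weight is
almost doubled, so `K ≥ c β ^ n` for any prescribed `β < 2`.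

The prefactors disappear after taking `log₂` and dividing by `n`. The infimum is attained because,
for each pair `f, g`, the inequality is a closed condition on `K`. -/

noncomputable section

namespace SobolevProduct

/-! ### Products in `L²` as convolutions of Fourier transforms. -/

section FourierConvolution

open SchwartzMap

variable {E : Type*} [NormedAddCommGroup E] [InnerProductSpace ℝ E] [FiniteDimensional ℝ E]
  [MeasurableSpace E] [BorelSpace E]

/-- On `L² ∩ L¹`, the `L²` inverse Fourier transform is given by the integral formula. -/
theorem coeFn_fourierInv_ae_eq (u : Lp ℂ 2 (volume : Measure E)) (hu : Integrable (u : E → ℂ)) :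
    ((𝓕⁻ u : Lp ℂ 2 (volume : Measure E)) : E → ℂ) =ᵐ[volume] 𝓕⁻ (u : E → ℂ) := by
  have hcont : Continuous (𝓕⁻ (u : E → ℂ)) :=
    VectorFourier.fourierIntegral_continuous (μ := volume) Real.continuous_fourierChar
      (L := -innerₗ E) (by simpa using! continuous_inner.neg) hu
  refine ae_eq_of_integral_contDiff_smul_eq
    ((Lp.memLp (𝓕⁻ u : Lp ℂ 2 (volume : Measure E))).locallyIntegrable (by norm_num))
    hcont.locallyIntegrable fun g hg hgc => ?_
  have hgc' : HasCompactSupport (fun x => (g x : ℂ)) :=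
    hgc.comp_left (g := Complex.ofReal) Complex.ofReal_zero
  let φ : 𝓢(E, ℂ) := hgc'.toSchwartzMap (Complex.ofRealCLM.contDiff.comp hg)
  -- Both sides are tested against `φ`: the `L²` transform is the distributional one, and Fubini
  -- moves the integral transform onto `φ` as well.
  have h1 := congrArg (fun T => T φ) (Lp.fourierInv_toTemperedDistribution_eq u)
  simp only [TemperedDistribution.fourierInv_apply, Lp.toTemperedDistribution_apply] at h1
  have h2 : ∫ x, (𝓕⁻ φ) x • (u : E → ℂ) x = ∫ x, φ x • 𝓕⁻ (u : E → ℂ) x := by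
    rw [SchwartzMap.fourierInv_coe]
    have := VectorFourier.integral_fourierIntegral_smul_eq_flip (L := -innerₗ E)
      (μ := volume) (ν := volume)
      Real.continuous_fourierChar (by simpa using! continuous_inner.neg) φ.integrable hu
    have hflip : (-innerₗ E).flip = -innerₗ E := by
      ext x y; simp [real_inner_comm]
    rw [hflip] at this
    exact this
  have h3 : ∀ F : E → ℂ, ∫ x, g x • F x = ∫ x, φ x • F x := fun F => by
    refine integral_congr_ae (Eventually.of_forall fun x => ?_)
    have : φ x = (g x : ℂ) := rfl
    simp [this]
  rw [h3, h3, ← h1, h2]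

/-- The inverse Fourier transform of a convolution is the product of the inverse transforms. -/
theorem fourierInv_convolution_eq {u v : E → ℂ} (hu : Integrable u) (hv : Integrable v) (x : E) :
    𝓕⁻ (convolution u v (ContinuousLinearMap.mul ℂ ℂ)) x = 𝓕⁻ u x * 𝓕⁻ v x := by
  simp only [Real.fourierInv_eq_fourier_neg]
  exact Real.fourier_mul_convolution_eq hu hv (-x)

/-- If the Fourier transforms of `f, g ∈ L²` are integrable and their convolution is in `L²`, then
`f g` is in `L²` and its Fourier transform is this convolution. -/
theorem exists_mul_fourier_eq_convolution (f g : Lp ℂ 2 (volume : Measure E))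
    (hf : Integrable ((𝓕 f : Lp ℂ 2 (volume : Measure E)) : E → ℂ))
    (hg : Integrable ((𝓕 g : Lp ℂ 2 (volume : Measure E)) : E → ℂ))
    (hfg : MemLp (convolution ((𝓕 f : Lp ℂ 2 (volume : Measure E)) : E → ℂ) ((𝓕 g : Lp ℂ 2 (volume : Measure E)) : E → ℂ)
      (ContinuousLinearMap.mul ℂ ℂ)) 2 volume) :
    ∃ h : Lp ℂ 2 (volume : Measure E), (∀ᵐ x, h x = f x * g x) ∧
      ((𝓕 h : Lp ℂ 2 (volume : Measure E)) : E → ℂ) =ᵐ[volume]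
        convolution ((𝓕 f : Lp ℂ 2 (volume : Measure E)) : E → ℂ) ((𝓕 g : Lp ℂ 2 (volume : Measure E)) : E → ℂ)
          (ContinuousLinearMap.mul ℂ ℂ) := by
  have hF : 𝓕 (𝓕⁻ (hfg.toLp _) : Lp ℂ 2 (volume : Measure E)) = hfg.toLp _ :=
    FourierTransform.fourier_fourierInv_eq _
  refine ⟨𝓕⁻ (hfg.toLp _), ?_, by rw [hF]; exact hfg.coeFn_toLp⟩
  have hi := hf.integrable_convolution (μ := volume) (ContinuousLinearMap.mul ℂ ℂ) hg
  have h1 := coeFn_fourierInv_ae_eq (hfg.toLp _) (hi.congr hfg.coeFn_toLp.symm)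
  have h2 := coeFn_fourierInv_ae_eq (𝓕 f) hf
  have h3 := coeFn_fourierInv_ae_eq (𝓕 g) hg
  rw [FourierTransform.fourierInv_fourier_eq] at h2 h3
  filter_upwards [h1, h2, h3] with x h1 h2 h3
  rw [h1, h2, h3, ← fourierInv_convolution_eq hf hg, Real.fourierInv_eq, Real.fourierInv_eq]
  refine integral_congr_ae ?_
  filter_upwards [hfg.coeFn_toLp] with y hy
  rw [hy]

end FourierConvolution

/-! ### Young's inequality. -/

section Young

variable {G : Type*} [AddCommGroup G] [MeasurableSpace G] [MeasurableAdd₂ G] [MeasurableNeg G]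
  {μ : Measure G} [SFinite μ] [μ.IsAddLeftInvariant]

/-- Young's convolution inequality `L¹ * L² ⊆ L²` for nonnegative functions. -/
theorem eLpNorm_two_lconvolution_le {φ ψ : G → ℝ≥0∞} (hφ : AEMeasurable φ μ)
    (hψ : AEMeasurable ψ μ) :
    eLpNorm (lconvolution φ ψ μ) 2 μ ≤ eLpNorm φ 1 μ * eLpNorm ψ 2 μ := by
  -- Cauchy–Schwarz after writing `φ ψ = φ^(1/2) · (φ^(1/2) ψ)`; integrating in `x` then only needs
  -- translation invariance.
  have hcs : ∀ x, lconvolution φ ψ μ x ^ (2 : ℝ) ≤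
      (∫⁻ y, φ y ∂μ) * ∫⁻ y, φ y * ψ (-y + x) ^ (2 : ℝ) ∂μ := by
    intro x
    have hψx : AEMeasurable (fun y => ψ (-y + x)) μ := by
      simp_rw [← sub_eq_neg_add]
      exact hψ.comp_quasiMeasurePreserving (quasiMeasurePreserving_sub_left μ x)
    have h := ENNReal.lintegral_mul_le_Lp_mul_Lq μ (p := 2) (q := 2)
      ⟨by norm_num, by norm_num, by norm_num⟩
      (f := fun y => φ y ^ (1 / 2 : ℝ)) (g := fun y => φ y ^ (1 / 2 : ℝ) * ψ (-y + x))
      (hφ.pow_const _) ((hφ.pow_const _).mul hψx)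
    have hsq : ∀ c : ℝ≥0∞, (c ^ (1 / 2 : ℝ)) ^ (2 : ℝ) = c := fun c => by
      rw [← ENNReal.rpow_mul]; norm_num
    have hl : ∀ y, φ y ^ (1 / 2 : ℝ) * (φ y ^ (1 / 2 : ℝ) * ψ (-y + x)) = φ y * ψ (-y + x) :=
      fun y => by
        rw [← mul_assoc, ← ENNReal.rpow_add_of_nonneg _ _ (by norm_num) (by norm_num)]; norm_num
    simp only [Pi.mul_apply, hl, ENNReal.mul_rpow_of_nonneg _ _ (zero_le_two : (0 : ℝ) ≤ 2),
      hsq] at h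
    calc lconvolution φ ψ μ x ^ (2 : ℝ) ≤ _ := ENNReal.rpow_le_rpow h zero_le_two
      _ = _ := by rw [ENNReal.mul_rpow_of_nonneg _ _ zero_le_two, hsq, hsq]
  have hint : ∫⁻ x, ∫⁻ y, φ y * ψ (-y + x) ^ (2 : ℝ) ∂μ ∂μ =
      (∫⁻ y, φ y ∂μ) * ∫⁻ x, ψ x ^ (2 : ℝ) ∂μ := by
    rw [lintegral_lintegral_swap (by fun_prop)]
    have : ∀ y, ∫⁻ x, φ y * ψ (-y + x) ^ (2 : ℝ) ∂μ = φ y * ∫⁻ x, ψ x ^ (2 : ℝ) ∂μ := fun y => by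
      rw [lintegral_const_mul'', lintegral_add_left_eq_self (fun x => ψ x ^ (2 : ℝ)) (-y)]
      fun_prop
    simp_rw [this]
    exact lintegral_mul_const'' _ hφ
  have hconv : AEMeasurable (fun x => ∫⁻ y, φ y * ψ (-y + x) ^ (2 : ℝ) ∂μ) μ :=
    aemeasurable_lconvolution hφ (hψ.pow_const _)
  rw [← ENNReal.rpow_le_rpow_iff (zero_lt_two : (0 : ℝ) < 2),
    ENNReal.mul_rpow_of_nonneg _ _ zero_le_two]
  simp only [eLpNorm_eq_lintegral_rpow_enorm_toReal two_ne_zero ENNReal.ofNat_ne_top,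
    eLpNorm_one_eq_lintegral_enorm, enorm_eq_self, ENNReal.toReal_ofNat]
  rw [← ENNReal.rpow_mul, ← ENNReal.rpow_mul]
  norm_num only [ENNReal.rpow_one]
  calc ∫⁻ x, lconvolution φ ψ μ x ^ (2 : ℝ) ∂μ
      ≤ ∫⁻ x, (∫⁻ y, φ y ∂μ) * ∫⁻ y, φ y * ψ (-y + x) ^ (2 : ℝ) ∂μ ∂μ := lintegral_mono hcs
    _ = _ := by
      rw [lintegral_const_mul'' _ hconv, hint, ← mul_assoc]
      norm_num [pow_two]

end Young

end SobolevProduct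

end

/-! ### Weighted norms in frequency and the upper bound. -/

noncomputable section

namespace SobolevProduct

variable {d : ℕ}

/-- The weight `√(1 + |k|²)` at `k = 2 π ξ`. -/
def bracket (ξ : EuclideanSpace ℝ (Fin d)) : ℝ := Real.sqrt (1 + ‖(2 * Real.pi) • ξ‖ ^ 2)

lemma one_le_bracket (ξ : EuclideanSpace ℝ (Fin d)) : 1 ≤ bracket ξ :=
  Real.one_le_sqrt.2 (by nlinarith [sq_nonneg ‖(2 * Real.pi) • ξ‖])

lemma bracket_pos (ξ : EuclideanSpace ℝ (Fin d)) : 0 < bracket ξ :=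
  zero_lt_one.trans_le (one_le_bracket ξ)

lemma continuous_bracket : Continuous (bracket : EuclideanSpace ℝ (Fin d) → ℝ) := by
  unfold bracket; fun_prop

lemma continuous_bracket_rpow (s : ℝ) :
    Continuous (fun ξ : EuclideanSpace ℝ (Fin d) => bracket ξ ^ s) :=
  continuous_bracket.rpow_const fun ξ => Or.inl (bracket_pos ξ).ne'

lemma bracket_eq (ξ : EuclideanSpace ℝ (Fin d)) :
    bracket ξ = Real.sqrt (1 + (2 * Real.pi * ‖ξ‖) ^ 2) := by
  rw [bracket, norm_smul, Real.norm_of_nonneg (by positivity)]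

lemma bracket_add_le (x y : EuclideanSpace ℝ (Fin d)) :
    bracket (x + y) ≤ 2 * max (bracket x) (bracket y) := by
  wlog h : ‖x‖ ≤ ‖y‖ generalizing x y
  · rw [add_comm, max_comm]; exact this y x (le_of_not_ge h)
  refine le_trans ?_ (mul_le_mul_of_nonneg_left (le_max_right _ _) zero_le_two)
  rw [bracket_eq, bracket_eq]
  refine Real.sqrt_le_iff.2 ⟨by positivity, ?_⟩
  rw [mul_pow _ (Real.sqrt _), Real.sq_sqrt (by positivity)]
  have h2 : 2 * Real.pi * ‖x + y‖ ≤ 2 * (2 * Real.pi * ‖y‖) := by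
    nlinarith [norm_add_le x y, Real.pi_pos]
  have := pow_le_pow_left₀ (by positivity) h2 2
  linarith

lemma bracket_rpow_add_le {n : ℝ} (hn : 0 ≤ n) (x y : EuclideanSpace ℝ (Fin d)) :
    bracket (x + y) ^ n ≤ 2 ^ n * (bracket x ^ n + bracket y ^ n) := by
  have hx := bracket_pos x
  have hy := bracket_pos y
  calc bracket (x + y) ^ n ≤ (2 * max (bracket x) (bracket y)) ^ n :=
        Real.rpow_le_rpow (bracket_pos _).le (bracket_add_le x y) hn
    _ = 2 ^ n * max (bracket x) (bracket y) ^ n :=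
        Real.mul_rpow zero_le_two (le_max_of_le_left hx.le)
    _ ≤ 2 ^ n * (bracket x ^ n + bracket y ^ n) := by
        gcongr
        rcases max_choice (bracket x) (bracket y) with h | h <;> rw [h]
        · linarith [Real.rpow_pos_of_pos hy n]
        · linarith [Real.rpow_pos_of_pos hx n]

/-- The Sobolev norm of order `s` in terms of the Fourier transform `u` in Mathlib's normalization,
as an extended nonnegative real. -/
def freqNorm (s : ℝ) (u : EuclideanSpace ℝ (Fin d) → ℂ) : ℝ≥0∞ :=
  eLpNorm (fun ξ => ((bracket ξ ^ s : ℝ) : ℂ) * u ξ) 2 volume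

lemma aestronglyMeasurable_bracket_mul (s : ℝ) {u : EuclideanSpace ℝ (Fin d) → ℂ}
    (hu : AEStronglyMeasurable u volume) :
    AEStronglyMeasurable (fun ξ => ((bracket ξ ^ s : ℝ) : ℂ) * u ξ) volume :=
  (Complex.continuous_ofReal.comp (continuous_bracket_rpow s)).aestronglyMeasurable.mul hu

lemma enorm_ofReal_bracket (s : ℝ) (ξ : EuclideanSpace ℝ (Fin d)) :
    ‖((bracket ξ ^ s : ℝ) : ℂ)‖ₑ = ENNReal.ofReal (bracket ξ ^ s) := by
  rw [← ofReal_norm, Complex.norm_real,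
    Real.norm_of_nonneg (Real.rpow_nonneg (bracket_pos ξ).le _)]

lemma enorm_bracket_mul (s : ℝ) (u : EuclideanSpace ℝ (Fin d) → ℂ)
    (ξ : EuclideanSpace ℝ (Fin d)) :
    ‖((bracket ξ ^ s : ℝ) : ℂ) * u ξ‖ₑ = ENNReal.ofReal (bracket ξ ^ s) * ‖u ξ‖ₑ := by
  rw [enorm_mul, enorm_ofReal_bracket]

lemma freqNorm_congr {s : ℝ} {u v : EuclideanSpace ℝ (Fin d) → ℂ} (h : u =ᵐ[volume] v) :
    freqNorm s u = freqNorm s v :=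
  eLpNorm_congr_ae (by filter_upwards [h] with ξ hξ; rw [hξ])

lemma freqNorm_zero (u : EuclideanSpace ℝ (Fin d) → ℂ) : freqNorm 0 u = eLpNorm u 2 volume := by
  simp [freqNorm]

lemma freqNorm_mono {s t : ℝ} (hst : s ≤ t) (u : EuclideanSpace ℝ (Fin d) → ℂ) :
    freqNorm s u ≤ freqNorm t u := by
  refine eLpNorm_mono_enorm fun ξ => ?_
  rw [enorm_bracket_mul, enorm_bracket_mul]
  gcongr
  exact one_le_bracket ξ

lemma weightedFourier_eq (n : ℝ) (f : L2 d) :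
    weightedFourier n f = (((2 * Real.pi) ^ (-(d : ℝ) / 2) : ℝ) : ℂ) •
      ((fun ξ => ((bracket ξ ^ n : ℝ) : ℂ) * (𝓕 f : L2 d) ξ) ∘ ((2 * Real.pi)⁻¹ • ·)) := by
  ext k
  have : bracket ((2 * Real.pi)⁻¹ • k) = Real.sqrt (1 + ‖k‖ ^ 2) := by
    rw [bracket, smul_inv_smul₀ (by positivity)]
  simp only [weightedFourier, angularFourier, Pi.smul_apply, Function.comp_apply, this, smul_eq_mul]
  ring

lemma aestronglyMeasurable_weightedFourier (n : ℝ) (f : L2 d) :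
    AEStronglyMeasurable (weightedFourier n f) volume := by
  rw [weightedFourier_eq]
  refine ((aestronglyMeasurable_bracket_mul n
    (Lp.aestronglyMeasurable _)).comp_quasiMeasurePreserving ?_).const_smul _
  exact ⟨by fun_prop, Measure.quasiMeasurePreserving_smul volume (by positivity) |>.2⟩

/-- The prefactor `(2π)^(-d/2)` exactly cancels the square root of the Jacobian of `k = 2πξ`, so the
two normalizations give the same norm. -/
lemma eLpNorm_weightedFourier (n : ℝ) (f : L2 d) :
    eLpNorm (weightedFourier n f) 2 volume = freqNorm n (𝓕 f : L2 d) := by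
  have hpi : (0 : ℝ) < 2 * Real.pi := by positivity
  have hmap := Measure.map_addHaar_smul (volume : Measure (EuclideanSpace ℝ (Fin d)))
    (inv_ne_zero hpi.ne')
  have hm := aestronglyMeasurable_bracket_mul n (Lp.aestronglyMeasurable (𝓕 f : L2 d))
  rw [weightedFourier_eq, eLpNorm_const_smul, ← eLpNorm_map_measure, hmap,
    eLpNorm_smul_measure_of_ne_top ENNReal.ofNat_ne_top, smul_eq_mul, ← mul_assoc]
  · rw [← freqNorm]
    convert one_mul _
    rw [← ofReal_norm, Complex.norm_real, Real.norm_of_nonneg (by positivity),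
      ENNReal.ofReal_rpow_of_nonneg (by positivity) (by positivity),
      ← ENNReal.ofReal_mul (by positivity), ← ENNReal.ofReal_one]
    congr 1
    rw [abs_of_pos (by positivity), finrank_euclideanSpace_fin, inv_pow, inv_inv,
      ← Real.rpow_natCast, ← Real.rpow_mul hpi.le, ← Real.rpow_add hpi]
    convert Real.rpow_zero _ using 2
    simp
    ring
  · rw [hmap]
    exact hm.smul_measure _
  · fun_prop

lemma memH_iff {n : ℝ} {f : L2 d} : MemH n f ↔ freqNorm n (𝓕 f : L2 d) < ∞ := by
  rw [← eLpNorm_weightedFourier]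
  exact ⟨fun h => h.2, fun h => ⟨aestronglyMeasurable_weightedFourier n f, h⟩⟩

lemma sobolevNorm_eq (n : ℝ) (f : L2 d) : sobolevNorm n f = (freqNorm n (𝓕 f : L2 d)).toReal := by
  rw [sobolevNorm, eLpNorm_weightedFourier]

/-- The norm of the embedding of `H^a` into the functions with integrable Fourier transform. -/
def embeddingConstant (d : ℕ) (a : ℝ) : ℝ≥0∞ :=
  eLpNorm (fun ξ : EuclideanSpace ℝ (Fin d) => bracket ξ ^ (-a)) 2 volume

/-- This is where `a > d/2` enters: `⟨ξ⟩ ^ (-2a)` is integrable since `2a` exceeds the dimension. -/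
lemma embeddingConstant_lt_top {a : ℝ} (ha : (d : ℝ) / 2 < a) : embeddingConstant d a < ∞ := by
  have ha0 : 0 ≤ a := le_trans (by positivity) ha.le
  have hint : Integrable (fun ξ : EuclideanSpace ℝ (Fin d) => ((1 : ℝ) + ‖ξ‖ ^ 2) ^ (-(2 * a) / 2)) :=
    integrable_rpow_neg_one_add_norm_sq (by rw [finrank_euclideanSpace_fin]; linarith)
  refine MemLp.eLpNorm_lt_top (μ := volume) ((memLp_two_iff_integrable_sq
    (continuous_bracket_rpow (-a)).aestronglyMeasurable).2 ?_)
  refine hint.mono' ((continuous_bracket_rpow (-a)).pow 2).aestronglyMeasurable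
    (Eventually.of_forall fun ξ => ?_)
  rw [Real.norm_of_nonneg (by positivity), ← Real.rpow_natCast, ← Real.rpow_mul (bracket_pos ξ).le,
    bracket_eq, Real.sqrt_eq_rpow, ← Real.rpow_mul (by positivity)]
  have : (1 / 2 : ℝ) * (-a * (2 : ℕ)) = -(2 * a) / 2 := by push_cast; ring
  rw [this]
  refine Real.rpow_le_rpow_of_nonpos (by positivity) ?_ (by linarith)
  have : ‖ξ‖ ≤ 2 * Real.pi * ‖ξ‖ := by nlinarith [Real.pi_gt_three, norm_nonneg ξ]
  gcongr

/-- Cauchy–Schwarz applied to `u = ⟨ξ⟩ ^ (-a) · (⟨ξ⟩ ^ a u)`. -/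
lemma eLpNorm_one_le_freqNorm (a : ℝ) {u : EuclideanSpace ℝ (Fin d) → ℂ}
    (hu : AEStronglyMeasurable u volume) :
    eLpNorm u 1 volume ≤ embeddingConstant d a * freqNorm a u := by
  have h := eLpNorm_smul_le_mul_eLpNorm (p := 2) (q := 2) (r := 1)
    (aestronglyMeasurable_bracket_mul a hu)
    (continuous_bracket_rpow (d := d) (-a)).aestronglyMeasurable
  refine le_trans (le_of_eq ?_) h
  congr 1
  ext ξ
  have hb := bracket_pos ξ
  have : bracket ξ ^ (-a) * bracket ξ ^ a = 1 := by
    rw [← Real.rpow_add hb, neg_add_cancel, Real.rpow_zero]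
  simp only [Pi.smul_apply', Complex.real_smul, ← mul_assoc]
  rw [← Complex.ofReal_mul, this, Complex.ofReal_one, one_mul]

lemma integrable_of_freqNorm_lt_top {a : ℝ} (ha : (d : ℝ) / 2 < a)
    {u : EuclideanSpace ℝ (Fin d) → ℂ} (hu : AEStronglyMeasurable u volume)
    (h : freqNorm a u < ∞) : Integrable u :=
  memLp_one_iff_integrable.1 ⟨hu, (eLpNorm_one_le_freqNorm a hu).trans_lt
    (ENNReal.mul_lt_top (embeddingConstant_lt_top ha) h)⟩

/-- The convolution of complex functions on `ℝ^d`. -/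
abbrev conv (u v : EuclideanSpace ℝ (Fin d) → ℂ) : EuclideanSpace ℝ (Fin d) → ℂ :=
  convolution u v (ContinuousLinearMap.mul ℂ ℂ)

/-- The weight at `x = y + (x - y)` is shared between the two factors, so each resulting convolution
carries the weight on one factor only; that factor is measured in `L²`, the other in `L¹`. -/
lemma freqNorm_conv_le {n : ℝ} (hn : 0 ≤ n) {u v : EuclideanSpace ℝ (Fin d) → ℂ}
    (hu : AEStronglyMeasurable u volume) (hv : AEStronglyMeasurable v volume) :
    freqNorm n (conv u v) ≤ ENNReal.ofReal (2 ^ n) *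
      (eLpNorm v 1 volume * freqNorm n u + eLpNorm u 1 volume * freqNorm n v) := by
  set φ : EuclideanSpace ℝ (Fin d) → ℝ≥0∞ := fun ξ => ‖u ξ‖ₑ with hφ
  set ψ : EuclideanSpace ℝ (Fin d) → ℝ≥0∞ := fun ξ => ‖v ξ‖ₑ with hψ
  set φn : EuclideanSpace ℝ (Fin d) → ℝ≥0∞ := fun ξ => ‖((bracket ξ ^ n : ℝ) : ℂ) * u ξ‖ₑ with hφn
  set ψn : EuclideanSpace ℝ (Fin d) → ℝ≥0∞ := fun ξ => ‖((bracket ξ ^ n : ℝ) : ℂ) * v ξ‖ₑ with hψn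
  have mφ : AEMeasurable φ volume := hu.enorm
  have mψ : AEMeasurable ψ volume := hv.enorm
  have mφn : AEMeasurable φn volume := (aestronglyMeasurable_bracket_mul n hu).enorm
  have mψn : AEMeasurable ψn volume := (aestronglyMeasurable_bracket_mul n hv).enorm
  have h1 : eLpNorm (lconvolution φn ψ volume) 2 volume ≤ eLpNorm v 1 volume * freqNorm n u := by
    rw [lconvolution_comm]
    refine (eLpNorm_two_lconvolution_le mψ mφn).trans_eq ?_
    rw [hψ, hφn, eLpNorm_enorm, eLpNorm_enorm, freqNorm]
  have h2 : eLpNorm (lconvolution φ ψn volume) 2 volume ≤ eLpNorm u 1 volume * freqNorm n v := by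
    refine (eLpNorm_two_lconvolution_le mφ mψn).trans_eq ?_
    rw [hφ, hψn, eLpNorm_enorm, eLpNorm_enorm, freqNorm]
  have hpt : ∀ x, ‖((bracket x ^ n : ℝ) : ℂ) * conv u v x‖ₑ ≤
      ‖(ENNReal.ofReal (2 ^ n) * (lconvolution φn ψ volume + lconvolution φ ψn volume) x)‖ₑ := by
    intro x
    have mφnψ : AEMeasurable (fun y => φn y * ψ (-y + x)) volume := by
      simp_rw [← sub_eq_neg_add]
      exact mφn.mul (mψ.comp_quasiMeasurePreserving (quasiMeasurePreserving_sub_left volume x))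
    rw [enorm_bracket_mul, enorm_eq_self, Pi.add_apply, lconvolution, lconvolution,
      ← lintegral_add_left' mφnψ, ← lintegral_const_mul' _ _ ENNReal.ofReal_ne_top]
    refine (mul_le_mul_right (enorm_integral_le_lintegral_enorm _) _).trans ?_
    rw [← lintegral_const_mul' _ _ ENNReal.ofReal_ne_top]
    refine lintegral_mono fun y => ?_
    simp only [hφ, hψ, hφn, hψn, ContinuousLinearMap.mul_apply', enorm_mul,
      ← sub_eq_neg_add]
    simp only [enorm_ofReal_bracket]
    have hb : ENNReal.ofReal (bracket x ^ n) ≤ ENNReal.ofReal (2 ^ n) *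
        (ENNReal.ofReal (bracket y ^ n) + ENNReal.ofReal (bracket (x - y) ^ n)) := by
      rw [← ENNReal.ofReal_add (Real.rpow_nonneg (bracket_pos _).le _)
        (Real.rpow_nonneg (bracket_pos _).le _), ← ENNReal.ofReal_mul (by positivity)]
      refine ENNReal.ofReal_le_ofReal ?_
      have := bracket_rpow_add_le hn y (x - y)
      rwa [add_sub_cancel] at this
    refine (mul_le_mul_left hb _).trans_eq ?_
    ring
  calc freqNorm n (conv u v)
      ≤ eLpNorm (fun x => ENNReal.ofReal (2 ^ n) *
          (lconvolution φn ψ volume + lconvolution φ ψn volume) x) 2 volume :=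
        eLpNorm_mono_enorm hpt
    _ ≤ ENNReal.ofReal (2 ^ n) *
          eLpNorm (lconvolution φn ψ volume + lconvolution φ ψn volume) 2 volume := by
        exact eLpNorm_le_nnreal_smul_eLpNorm_of_ae_le_mul' (c := (2 ^ n : ℝ).toNNReal)
          (Eventually.of_forall fun x => le_rfl) 2
    _ ≤ _ := by
        gcongr
        refine (eLpNorm_add_le (aemeasurable_lconvolution mφn mψ).aestronglyMeasurable
          (aemeasurable_lconvolution mφ mψn).aestronglyMeasurable one_le_two).trans ?_
        gcongr

lemma freqNorm_conv_lt_top {n : ℝ} (hn : 0 ≤ n) {u v : EuclideanSpace ℝ (Fin d) → ℂ}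
    (hu : Integrable u) (hv : Integrable v) (hnu : freqNorm n u < ∞) (hnv : freqNorm n v < ∞) :
    freqNorm n (conv u v) < ∞ :=
  (freqNorm_conv_le hn hu.aestronglyMeasurable hv.aestronglyMeasurable).trans_lt <|
    ENNReal.mul_lt_top ENNReal.ofReal_lt_top <| ENNReal.add_lt_top.2
      ⟨ENNReal.mul_lt_top (memLp_one_iff_integrable.2 hv).2 hnu,
        ENNReal.mul_lt_top (memLp_one_iff_integrable.2 hu).2 hnv⟩

lemma memLp_conv {n : ℝ} (hn : 0 ≤ n) {u v : EuclideanSpace ℝ (Fin d) → ℂ}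
    (hu : Integrable u) (hv : Integrable v) (hnu : freqNorm n u < ∞) (hnv : freqNorm n v < ∞) :
    MemLp (conv u v) 2 volume :=
  ⟨(hu.integrable_convolution (μ := volume) _ hv).aestronglyMeasurable, by
    rw [← freqNorm_zero]
    exact (freqNorm_mono hn _).trans_lt (freqNorm_conv_lt_top hn hu hv hnu hnv)⟩

/-- For `f, g ∈ H^n`, the product bound is a bound on the convolution of the Fourier transforms. -/
lemma productBound_iff {a n C : ℝ} (ha : (d : ℝ) / 2 < a) (han : a ≤ n) {f g : L2 d}
    (hf : MemH n f) (hg : MemH n g) :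
    ProductBound n f g C ↔ (freqNorm n (conv (𝓕 f : L2 d) (𝓕 g : L2 d))).toReal ≤ C := by
  have hn : 0 ≤ n := le_trans (by positivity) (ha.le.trans han)
  rw [memH_iff] at hf hg
  have mf := Lp.aestronglyMeasurable (𝓕 f : L2 d)
  have mg := Lp.aestronglyMeasurable (𝓕 g : L2 d)
  have hif := integrable_of_freqNorm_lt_top (ha.trans_le han) mf hf
  have hig := integrable_of_freqNorm_lt_top (ha.trans_le han) mg hg
  have hlt := freqNorm_conv_lt_top hn hif hig hf hg
  have hconv := memLp_conv hn hif hig hf hg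
  obtain ⟨h, hfg, hh⟩ := exists_mul_fourier_eq_convolution f g hif hig hconv
  have hnorm := freqNorm_congr (s := n) hh
  constructor
  · rintro ⟨h', hfg', -, hC⟩
    have : h' = h := Lp.ext (by filter_upwards [hfg, hfg'] with x h1 h2; rw [h1, h2])
    rwa [this, sobolevNorm_eq, hnorm] at hC
  · intro hC
    exact ⟨h, hfg, by rw [memH_iff, hnorm]; exact hlt, by rwa [sobolevNorm_eq, hnorm]⟩

/-- The upper bound `K_{n,a,d} ≤ C 2^n`. -/
theorem isProductConstant_two_rpow {a n : ℝ} (ha : (d : ℝ) / 2 < a) (han : a ≤ n) :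
    IsProductConstant d n a (2 * (embeddingConstant d a).toReal * 2 ^ n) := by
  have hn : 0 ≤ n := le_trans (by positivity) (ha.le.trans han)
  rw [IsProductConstant, if_neg (not_le.2 (ha.trans_le han))]
  intro f g hf hg
  rw [productBound_iff ha han hf hg]
  rw [memH_iff] at hf hg
  have hfa := (freqNorm_mono han _).trans_lt hf
  have hga := (freqNorm_mono han _).trans_lt hg
  have mf := Lp.aestronglyMeasurable (𝓕 f : L2 d)
  have mg := Lp.aestronglyMeasurable (𝓕 g : L2 d)
  have hE := embeddingConstant_lt_top ha
  simp only [sobolevNorm_eq]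
  have h := freqNorm_conv_le hn mf mg
  have h' : freqNorm n (conv (𝓕 f : L2 d) (𝓕 g : L2 d)) ≤ ENNReal.ofReal (2 ^ n) *
      (embeddingConstant d a * freqNorm a (𝓕 g : L2 d) * freqNorm n (𝓕 f : L2 d) +
        embeddingConstant d a * freqNorm a (𝓕 f : L2 d) * freqNorm n (𝓕 g : L2 d)) := by
    refine h.trans ?_
    gcongr
    · exact eLpNorm_one_le_freqNorm a mg
    · exact eLpNorm_one_le_freqNorm a mf
  have h3 := ENNReal.toReal_mono (by finiteness) h'
  rw [ENNReal.toReal_mul, ENNReal.toReal_add (by finiteness) (by finiteness),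
    ENNReal.toReal_ofReal (by positivity)] at h3
  simp only [ENNReal.toReal_mul] at h3
  refine h3.trans ?_
  set A := (freqNorm a (𝓕 f : L2 d)).toReal
  set B := (freqNorm n (𝓕 g : L2 d)).toReal
  set A' := (freqNorm n (𝓕 f : L2 d)).toReal
  set B' := (freqNorm a (𝓕 g : L2 d)).toReal
  set E := (embeddingConstant d a).toReal
  have hE0 : 0 ≤ E := ENNReal.toReal_nonneg
  calc 2 ^ n * (E * B' * A' + E * A * B) = 2 ^ n * E * (A' * B' + A * B) := by ring
    _ ≤ 2 ^ n * E * (2 * max (A * B) (A' * B')) := by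
      gcongr
      linarith [le_max_left (A * B) (A' * B'), le_max_right (A * B) (A' * B')]
    _ = _ := by ring

end SobolevProduct

end

/-! ### Lower bound from concentrated frequencies, and attainment of the infimum. -/

noncomputable section

namespace SobolevProduct

variable {d : ℕ}

lemma freqNorm_le_of_bracket_le {s M : ℝ} (hs : 0 ≤ s) {u : EuclideanSpace ℝ (Fin d) → ℂ}
    (h : ∀ ξ, u ξ ≠ 0 → bracket ξ ≤ M) :
    freqNorm s u ≤ ENNReal.ofReal (M ^ s) * eLpNorm u 2 volume := by
  refine eLpNorm_le_nnreal_smul_eLpNorm_of_ae_le_mul' (c := (M ^ s : ℝ).toNNReal)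
    (Eventually.of_forall fun ξ => ?_) 2
  rw [enorm_bracket_mul]
  by_cases hξ : u ξ = 0
  · simp [hξ]
  · exact mul_le_mul_left (ENNReal.ofReal_le_ofReal
      (Real.rpow_le_rpow (bracket_pos ξ).le (h ξ hξ) hs)) _

lemma le_freqNorm_of_le_bracket {s m : ℝ} (hs : 0 ≤ s) (hm : 0 ≤ m)
    {u : EuclideanSpace ℝ (Fin d) → ℂ} (h : ∀ ξ, u ξ ≠ 0 → m ≤ bracket ξ) :
    ENNReal.ofReal (m ^ s) * eLpNorm u 2 volume ≤ freqNorm s u := by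
  have : ENNReal.ofReal (m ^ s) * eLpNorm u 2 volume = eLpNorm ((m ^ s : ℝ) • u) 2 volume := by
    rw [eLpNorm_const_smul, ← ofReal_norm, Real.norm_of_nonneg (by positivity)]
  rw [this]
  refine eLpNorm_mono_enorm fun ξ => ?_
  rw [enorm_bracket_mul, Pi.smul_apply, enorm_smul, ← ofReal_norm (m ^ s),
    Real.norm_of_nonneg (by positivity)]
  by_cases hξ : u ξ = 0
  · simp [hξ]
  · exact mul_le_mul_left (ENNReal.ofReal_le_ofReal (Real.rpow_le_rpow hm (h ξ hξ) hs)) _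

/-- No computation of the convolution is needed: if it vanished, injectivity of the Fourier
transform would give `f² = 0`, hence `f = 0`. -/
lemma eLpNorm_conv_self_ne_zero (f : L2 d) (hf : f ≠ 0) (hi : Integrable (𝓕 f : L2 d))
    (hconv : MemLp (conv (𝓕 f : L2 d) (𝓕 f : L2 d)) 2 volume) :
    eLpNorm (conv (𝓕 f : L2 d) (𝓕 f : L2 d)) 2 volume ≠ 0 := by
  intro h0
  obtain ⟨h, hff, hh⟩ := exists_mul_fourier_eq_convolution f f hi hi hconv
  rw [eLpNorm_eq_zero_iff hconv.1 two_ne_zero] at h0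
  have hF : (𝓕 h : L2 d) = 0 := (Lp.eq_zero_iff_ae_eq_zero).2 (hh.trans h0)
  have hz : h = 0 := (Lp.fourierTransformₗᵢ _ ℂ).map_eq_zero_iff.1 hF
  refine hf ((Lp.eq_zero_iff_ae_eq_zero).2 ?_)
  filter_upwards [hff, (Lp.eq_zero_iff_ae_eq_zero).1 hz] with x h1 h2
  rw [h2] at h1
  exact mul_self_eq_zero.1 h1.symm

/-- A lower bound for the constant from a function with Fourier transform in `bracket ≤ M`, whose
square has Fourier transform in `bracket ≥ m`. -/
theorem exists_const_mul_rpow_le {a : ℝ} (ha : (d : ℝ) / 2 < a) {m M : ℝ} (hm : 0 < m) (hM : 0 < M)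
    {u : EuclideanSpace ℝ (Fin d) → ℂ} (hu : MemLp u 2 volume)
    (hu0 : eLpNorm u 2 volume ≠ 0) (huM : ∀ ξ, u ξ ≠ 0 → bracket ξ ≤ M)
    (hum : ∀ ξ, conv u u ξ ≠ 0 → m ≤ bracket ξ) :
    ∃ c : ℝ, 0 < c ∧ ∀ n K : ℝ, a ≤ n → IsProductConstant d n a K → c * (m / M) ^ n ≤ K := by
  have ha0 : 0 ≤ a := le_trans (by positivity) ha.le
  obtain ⟨f, hf⟩ : ∃ f : L2 d, (𝓕 f : L2 d) = hu.toLp u :=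
    ⟨𝓕⁻ (hu.toLp u), FourierTransform.fourier_fourierInv_eq _⟩
  have hfu : ((𝓕 f : L2 d) : EuclideanSpace ℝ (Fin d) → ℂ) =ᵐ[volume] u := by
    rw [hf]; exact hu.coeFn_toLp
  have hcc : conv (𝓕 f : L2 d) (𝓕 f : L2 d) = conv u u := convolution_congr _ hfu hfu
  have hM2 : ∀ s, 0 ≤ s →
      freqNorm s (𝓕 f : L2 d) ≤ ENNReal.ofReal (M ^ s) * eLpNorm u 2 volume := fun s hs => by
    rw [freqNorm_congr hfu]
    exact freqNorm_le_of_bracket_le hs huM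
  have hfin : ∀ s, 0 ≤ s → freqNorm s (𝓕 f : L2 d) < ∞ := fun s hs =>
    (hM2 s hs).trans_lt (ENNReal.mul_lt_top ENNReal.ofReal_lt_top hu.2)
  have hi := integrable_of_freqNorm_lt_top ha (Lp.aestronglyMeasurable _) (hfin a ha0)
  have hconv := memLp_conv ha0 hi hi (hfin a ha0) (hfin a ha0)
  have hf0 : f ≠ 0 := by
    rintro rfl
    refine hu0 ((eLpNorm_eq_zero_iff hu.1 two_ne_zero).2 (hfu.symm.trans ?_))
    exact (Lp.eq_zero_iff_ae_eq_zero).1 (map_zero (Lp.fourierTransformₗᵢ _ ℂ))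
  have hq0 := eLpNorm_conv_self_ne_zero f hf0 hi hconv
  rw [hcc] at hq0 hconv
  set q := (eLpNorm (conv u u) 2 volume).toReal with hq
  set l := (eLpNorm u 2 volume).toReal with hl
  have hqpos : 0 < q := ENNReal.toReal_pos hq0 hconv.2.ne
  have hlpos : 0 < l := ENNReal.toReal_pos hu0 hu.2.ne
  have hA : ∀ s, 0 ≤ s → (freqNorm s (𝓕 f : L2 d)).toReal ≤ M ^ s * l := fun s hs => by
    have := ENNReal.toReal_mono (ENNReal.mul_ne_top ENNReal.ofReal_ne_top hu.2.ne) (hM2 s hs)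
    rwa [ENNReal.toReal_mul, ENNReal.toReal_ofReal (by positivity)] at this
  -- Comes from `m ^ n q ≤ ‖f²‖_n ≤ K ‖f‖_a ‖f‖_n ≤ K (M ^ a l) (M ^ n l)`.
  refine ⟨q / (M ^ a * l ^ 2), by positivity, fun n K hn hK => ?_⟩
  have hn0 := ha0.trans hn
  rw [IsProductConstant, if_neg (not_le.2 (ha.trans_le hn))] at hK
  have hfn : MemH n f := memH_iff.2 (hfin n hn0)
  have h := hK f f hfn hfn
  rw [productBound_iff ha hn hfn hfn, hcc, mul_comm (sobolevNorm n f), max_self, sobolevNorm_eq,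
    sobolevNorm_eq] at h
  have hlow : m ^ n * q ≤ (freqNorm n (conv u u)).toReal := by
    have hlt := freqNorm_conv_lt_top hn0 hi hi (hfin n hn0) (hfin n hn0)
    rw [hcc] at hlt
    have := ENNReal.toReal_mono hlt.ne (le_freqNorm_of_le_bracket hn0 hm.le hum)
    rwa [ENNReal.toReal_mul, ENNReal.toReal_ofReal (by positivity)] at this
  have hpos : 0 < m ^ n * q := by positivity
  have hK0 : 0 ≤ K := by
    by_contra hneg
    have := mul_nonneg (ENNReal.toReal_nonneg (a := freqNorm a (𝓕 f : L2 d)))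
      (ENNReal.toReal_nonneg (a := freqNorm n (𝓕 f : L2 d)))
    nlinarith
  have hup : m ^ n * q ≤ K * ((M ^ a * l) * (M ^ n * l)) := by
    refine hlow.trans (h.trans ?_)
    gcongr
    · exact hA a ha0
    · exact hA n hn0
  rw [Real.div_rpow hm.le hM.le, div_mul_div_comm, div_le_iff₀ (by positivity)]
  linarith

/-- The lower bound `K ≥ c β^n` for every `β < 2`. -/
theorem exists_lower_bound (hd : 1 ≤ d) {a : ℝ} (ha : (d : ℝ) / 2 < a) {β : ℝ} (hβ0 : 0 < β)
    (hβ : β < 2) :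
    ∃ c : ℝ, 0 < c ∧ ∀ n K : ℝ, a ≤ n → IsProductConstant d n a K → c * β ^ n ≤ K := by
  -- Solves `2 (R - 1) = β (R + 1) + 3`. The slack 3 absorbs the 1 inside the square roots, giving
  -- `β M ≤ m`.
  set R : ℝ := (5 + β) / (2 - β) with hRdef
  have hR : R * (2 - β) = 5 + β := div_mul_cancel₀ _ (by linarith)
  have hR1 : 1 ≤ R := by rw [hRdef, one_le_div (by linarith)]; linarith
  let e : EuclideanSpace ℝ (Fin d) := EuclideanSpace.single ⟨0, hd⟩ R
  have he : ‖e‖ = R := by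
    simp only [e, PiLp.norm_single, Real.norm_eq_abs, abs_of_nonneg (zero_le_one.trans hR1)]
  set m := Real.sqrt (1 + (2 * Real.pi * (2 * (R - 1))) ^ 2) with hm
  set M := Real.sqrt (1 + (2 * Real.pi * (R + 1)) ^ 2) with hM
  have hm0 : 0 < m := Real.sqrt_pos.2 (by positivity)
  have hM0 : 0 < M := Real.sqrt_pos.2 (by positivity)
  have hβm : β ≤ m / M := by
    rw [le_div_iff₀ hM0]
    refine Real.le_sqrt_of_sq_le ?_
    rw [mul_pow, hM, Real.sq_sqrt (by positivity)]
    have h1 : 2 * (R - 1) = β * (R + 1) + 3 := by linarith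
    have h2 : 0 ≤ β * (R + 1) := by positivity
    have h3 : 9 ≤ (2 * (R - 1)) ^ 2 - (β * (R + 1)) ^ 2 := by rw [h1]; nlinarith
    have h4 : (1 : ℝ) ≤ (2 * Real.pi) ^ 2 := by nlinarith [Real.pi_gt_three]
    nlinarith
  set u : EuclideanSpace ℝ (Fin d) → ℂ := (Metric.ball e 1).indicator fun _ => 1 with hu
  have hsupp : Function.support u ⊆ Metric.ball e 1 := Set.support_indicator_subset
  have hmem : MemLp u 2 volume :=
    memLp_indicator_const 2 measurableSet_ball 1 (Or.inr measure_ball_lt_top.ne)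
  have hne : eLpNorm u 2 volume ≠ 0 := by
    rw [hu, eLpNorm_indicator_const measurableSet_ball two_ne_zero ENNReal.ofNat_ne_top]
    simp [(Metric.measure_ball_pos volume e one_pos).ne', measure_ball_lt_top.ne]
  obtain ⟨c, hc, h⟩ := exists_const_mul_rpow_le ha hm0 hM0 hmem hne
    (fun ξ hξ => by
      have h1 : ‖ξ - e‖ < 1 := mem_ball_iff_norm.1 (hsupp hξ)
      have h2 : ‖ξ‖ ≤ R + 1 := by
        have := norm_sub_norm_le ξ e
        linarith
      rw [bracket_eq, hM]
      gcongr)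
    (fun ξ hξ => by
      obtain ⟨y, hy, z, hz, rfl⟩ := support_convolution_subset _ hξ
      have hy1 : ‖y - e‖ < 1 := mem_ball_iff_norm.1 (hsupp hy)
      have hz1 : ‖z - e‖ < 1 := mem_ball_iff_norm.1 (hsupp hz)
      have h2 : 2 * (R - 1) ≤ ‖y + z‖ := by
        have h3 : ‖(2 : ℝ) • e‖ = 2 * R := by rw [norm_smul, he]; norm_num
        have h4 : (2 : ℝ) • e = (y + z) - ((y - e) + (z - e)) := by rw [two_smul]; abel
        have h5 := norm_sub_le (y + z) ((y - e) + (z - e))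
        have h6 := norm_add_le (y - e) (z - e)
        rw [← h4, h3] at h5
        linarith
      have : 0 ≤ R - 1 := by linarith
      show m ≤ bracket (y + z)
      rw [bracket_eq, hm]
      gcongr)
  refine ⟨c, hc, fun n K hn hK => le_trans ?_ (h n K hn hK)⟩
  have : 0 ≤ n := le_trans (by positivity) (ha.le.trans hn)
  gcongr

/-- For fixed `f, g` the condition reads `‖fg‖_n ≤ K B`, which passes to the infimum over `K`; when
`B = 0` it does not depend on `K`. -/
theorem isLeast_sharpConstant (hd : 1 ≤ d) {a n : ℝ} (ha : (d : ℝ) / 2 < a) (hn : a ≤ n) :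
    IsLeast {K : ℝ | IsProductConstant d n a K} (sharpConstant d n a) := by
  obtain ⟨c, -, hc⟩ := exists_lower_bound hd ha one_pos one_lt_two
  have hbdd : BddBelow {K : ℝ | IsProductConstant d n a K} := ⟨_, fun K hK => hc n K hn hK⟩
  have hne : {K : ℝ | IsProductConstant d n a K}.Nonempty := ⟨_, isProductConstant_two_rpow ha hn⟩
  refine ⟨?_, fun K hK => csInf_le hbdd hK⟩
  change IsProductConstant d n a _
  rw [IsProductConstant, if_neg (not_le.2 (ha.trans_le hn))]
  intro f g hf hg
  rw [productBound_iff ha hn hf hg]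
  set B := max (sobolevNorm a f * sobolevNorm n g) (sobolevNorm n f * sobolevNorm a g)
  have hB : 0 ≤ B :=
    le_max_of_le_left (mul_nonneg ENNReal.toReal_nonneg ENNReal.toReal_nonneg)
  have key : ∀ K ∈ {K : ℝ | IsProductConstant d n a K},
      (freqNorm n (conv (𝓕 f : L2 d) (𝓕 g : L2 d))).toReal ≤ K * B := fun K hK => by
    change IsProductConstant d n a K at hK
    rw [IsProductConstant, if_neg (not_le.2 (ha.trans_le hn))] at hK
    exact (productBound_iff ha hn hf hg).1 (hK f g hf hg)
  rcases hB.eq_or_lt with h0 | hpos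
  · obtain ⟨K, hK⟩ := hne
    simpa [← h0] using key K hK
  · rw [← div_le_iff₀ hpos]
    exact le_csInf hne fun K hK => (div_le_iff₀ hpos).2 (key K hK)

end SobolevProduct

end

/-! ### The logarithmic limit. -/

theorem corollary2p6 (d : ℕ) (hd : 1 ≤ d) (a : ℝ) (ha : (d : ℝ) / 2 < a) :
    (∀ n : ℝ, a ≤ n →
      IsLeast {K : ℝ | SobolevProduct.IsProductConstant d n a K}
        (SobolevProduct.sharpConstant d n a)) ∧
    Tendsto (fun n : ℝ => Real.logb 2 (SobolevProduct.sharpConstant d n a) / n)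
      atTop (𝓝 1) := by
  refine ⟨fun n hn => SobolevProduct.isLeast_sharpConstant hd ha hn, ?_⟩
  have hlim : ∀ x y : ℝ, Tendsto (fun n : ℝ => x / n + y) atTop (𝓝 y) := fun x y => by
    simpa using (tendsto_id.const_div_atTop x).add_const y
  have hlogb : ∀ {c β n : ℝ}, 0 < c → Real.logb 2 (c * (2 ^ β) ^ n) = Real.logb 2 c + n * β :=
    fun {c β n} hc => by
      rw [← Real.rpow_mul zero_le_two, Real.logb_mul hc.ne' (by positivity),
        Real.logb_rpow two_pos (by norm_num), mul_comm]
  refine tendsto_order.2 ⟨fun b hb => ?_, fun b hb => ?_⟩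
  -- The exponent is the midpoint of `b` and 1: below 1, so `β < 2`, yet above `b`, leaving room for
  -- `logb 2 c / n`.
  · have hβ : (2 : ℝ) ^ ((b + 1) / 2) < 2 := by
      conv_rhs => rw [← Real.rpow_one 2]
      exact Real.rpow_lt_rpow_of_exponent_lt one_lt_two (by linarith)
    obtain ⟨c, hc, h⟩ := SobolevProduct.exists_lower_bound hd ha (by positivity) hβ
    filter_upwards [eventually_ge_atTop a, eventually_gt_atTop 0,
      (hlim (Real.logb 2 c) ((b + 1) / 2)).eventually_const_lt (by linarith : b < (b + 1) / 2)]
      with n hn hn0 hlt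
    have hK := h n _ hn (SobolevProduct.isLeast_sharpConstant hd ha hn).1
    have hlog := Real.logb_le_logb_of_le one_lt_two (by positivity) hK
    rw [hlogb hc] at hlog
    refine hlt.trans_le ?_
    rw [le_div_iff₀ hn0, add_mul, div_mul_cancel₀ _ hn0.ne']
    linarith
  -- Here the lower bound, with `β = 1`, only supplies positivity of the sharp constant, so that its
  -- logarithm is monotone.
  · obtain ⟨c, hc, h⟩ := SobolevProduct.exists_lower_bound hd ha one_pos one_lt_two
    set C := 2 * (SobolevProduct.embeddingConstant d a).toReal
    filter_upwards [eventually_ge_atTop a, eventually_gt_atTop 0,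
      (hlim (Real.logb 2 C) 1).eventually_lt_const hb] with n hn hn0 hlt
    have hL := SobolevProduct.isLeast_sharpConstant hd ha hn
    have hK0 : 0 < SobolevProduct.sharpConstant d n a :=
      lt_of_lt_of_le (by positivity) (h n _ hn hL.1)
    have hKC : SobolevProduct.sharpConstant d n a ≤ C * 2 ^ n :=
      hL.2 (SobolevProduct.isProductConstant_two_rpow ha hn)
    have hC : 0 < C := pos_of_mul_pos_left (hK0.trans_le hKC) (by positivity)
    have hlog := Real.logb_le_logb_of_le one_lt_two hK0 hKC
    have hCn := hlogb (β := 1) (n := n) hC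
    rw [Real.rpow_one] at hCn
    refine lt_of_le_of_lt ?_ hlt
    rw [div_le_iff₀ hn0, add_mul, div_mul_cancel₀ _ hn0.ne']
    linarith
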